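/- For a finite set $s\subseteq\mathbb N$ and $t\subseteq\mathbb N$ write $s\sqsubseteq t$ if $s=t\cap\{m: m<n\}$ for some $n\in\mathbb N$. A family $\mathcal B$ of finite subsets of $\mathbb N$ is a front on $\mathbb N$ if its elements are pairwise $\sqsubseteq$-incomparable and every infinite $y\subseteq\mathbb N$ has an initial segment $s\sqsubseteq y$ with $s\in\mathcal B$. For a family $\mathcal F$ of finite subsets of $\mathbb N$, let $hom(\mathcal F)$ be the family of all $y\subseteq\mathbb N$ such that either every infinite $z\subseteq y$ has an initial segment in $\mathcal F$, or no finite subset of $y$ belongs to $\mathcal F$. An ideal on $\mathbb N$ is a family of subsets of $\mathbb N$ that contains all finite sets and is closed under subsets and finite unions. It is tall if every infinite $x\subseteq\mathbb N$ has an infinite subset belonging to it, and co-analytic if its complement is an analytic subset of $2^{\mathbb N}\cong\mathcal P(\mathbb N)$. **Theorem.** Let $\mathcal B$ be a front on $\mathbb N$. There is a co-analytic tall ideal $\mathcal I$ on $\mathbb N$ such that $hom(\mathcal F)\not\subseteq\mathcal I$ for every $\mathcal F\subseteq\mathcal B$. -/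

import Mathlib

/-- `s ⊑ t`: the finite set `s` is an initial segment of the (finite or infinite) set `t ⊆ ℕ`. The
empty set is an initial segment of every set. -/
def IsInitSeg (s : Finset ℕ) (t : Set ℕ) : Prop :=
  ∃ n : ℕ, (s : Set ℕ) = t ∩ Set.Iio n

/-- `B ⊆ [ℕ]^{<ω}` is a front on `x`: its elements are pairwise `⊑`-incomparable, and every infinite
subset of `x` has an initial segment in `B`. -/
structure IsFrontOn (B : Set (Finset ℕ)) (x : Set ℕ) : Prop where
  incomparable : ∀ s ∈ B, ∀ t ∈ B, s ≠ t → ¬ IsInitSeg s (t : Set ℕ)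
  exists_initSeg : ∀ y : Set ℕ, y ⊆ x → y.Infinite → ∃ s ∈ B, IsInitSeg s y

/-- `hom(F)`: the `F`-homogeneous sets, that is the sets `y ⊆ ℕ` such that either every infinite
subset of `y` has an initial segment in `F`, or no finite subset of `y` belongs to `F`. -/
def homFamily (F : Set (Finset ℕ)) : Set (Set ℕ) :=
  {y | (∀ z : Set ℕ, z ⊆ y → z.Infinite → ∃ s ∈ F, IsInitSeg s z) ∨
    (∀ s : Finset ℕ, (s : Set ℕ) ⊆ y → s ∉ F)}

/-- A family of subsets of `ℕ` is tall if every infinite set has an infinite subset in it. -/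
def IsTall (C : Set (Set ℕ)) : Prop :=
  ∀ x : Set ℕ, x.Infinite → ∃ y ∈ C, y.Infinite ∧ y ⊆ x

/-- Ideals on `ℕ`, with the usual convention that they contain all finite sets. -/
structure IsIdealOnNat (I : Set (Set ℕ)) : Prop where
  finite_mem : ∀ x : Set ℕ, x.Finite → x ∈ I
  hereditary : ∀ x ∈ I, ∀ y : Set ℕ, y ⊆ x → y ∈ I
  union_mem : ∀ x ∈ I, ∀ y ∈ I, x ∪ y ∈ I

/-- A family of subsets of `ℕ` is co-analytic if, under the identification of `𝒫(ℕ)` with the Cantor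
space `2^ℕ` (product topology) through characteristic functions, its complement is analytic. -/
def IsCoanalyticFamily (C : Set (Set ℕ)) : Prop :=
  MeasureTheory.AnalyticSet {f : ℕ → Bool | {n : ℕ | f n = true} ∉ C}

/-!
Let `B` be a front. The ideal is built from an almost disjoint family `(h F)`, indexed by all sets
`F` of finite sets, in which `h F` is infinite and, for `F ⊆ B`, belongs to `hom(F)`. A set `y` is in
the ideal when for every `F` the trace `y ∩ h F` has density zero relative to `h F`. Then no `h F` is
in the ideal, so `hom(F)` is not contained in it. The ideal is tall: if an infinite set `x` meets every
`h F` in a finite set, then `x` is itself in the ideal; otherwise `x ∩ h F` is infinite for some `F`,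
and any infinite subset of it that is sparse in `h F` is in the ideal, since it meets every other
`h G` in a finite set (`isTall_sparseIdeal`).

The complement of the ideal is the projection of a Borel set along `F` as soon as `F ↦ h F` is Borel
(`isCoanalyticFamily_sparseIdeal`). To get such a map, start with the branches `branch F` of a tree,
which depend on `F` in a Borel way and are almost disjoint, and choose `h F` inside `branch F`. The
choice is made by a Borel version of the Nash-Williams theorem (`IsFrontOn.hasBorelSelector`): there is
a Borel map that sends `F` and an infinite `x` to an infinite subset of `x` on which all elements of
`B`, or none, are in `F`. It is obtained by induction on the front, through the links
`{t | n < min t, {n} ∪ t ∈ B}`. Given selectors for all links, a fusion yields an infinite set in which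
the colour of an element of `B` depends on its minimum only, and keeping the minima of a colour that
occurs infinitely often gives a monochromatic set (`HasBorelSelector.of_linkAt`). All these steps are
Borel. The induction is well founded because every infinite set has an initial segment in `B`.
-/

open Set Filter Function

/-! ### Measurability of set-valued maps -/

theorem Measurable.mem_apply {α β : Type*} [MeasurableSpace α] {f : α → Set β}
    (hf : Measurable f) (b : β) : Measurable fun a => b ∈ f a :=
  measurable_set_iff.1 hf b

theorem Measurable.eq_apply_nat {α : Type*} [MeasurableSpace α] {f : α → ℕ}
    (hf : Measurable f) (m : ℕ) : Measurable fun a => m = f a :=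
  (measurable_from_top (f := fun j : ℕ => m = j)).comp hf

theorem measurable_sInf_nat : Measurable (sInf : Set ℕ → ℕ) := by
  refine measurable_to_countable' fun m => ?_
  have : (sInf : Set ℕ → ℕ) ⁻¹' {m} =
      {x | (m ∈ x ∧ ∀ j, j < m → j ∉ x) ∨ (m = 0 ∧ ∀ j, j ∉ x)} := by
    ext x
    simp only [mem_preimage, mem_singleton_iff, mem_ofPred_eq]
    constructor
    · rintro rfl
      rcases x.eq_empty_or_nonempty with rfl | hx
      · right; simp
      · exact Or.inl ⟨Nat.sInf_mem hx, fun j hj => Nat.notMem_of_lt_sInf hj⟩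
    · rintro (⟨h1, h2⟩ | ⟨rfl, h⟩)
      · refine le_antisymm (Nat.sInf_le h1) (not_lt.1 fun h => h2 _ h (Nat.sInf_mem ⟨m, h1⟩))
      · exact Nat.sInf_eq_zero.2 (Or.inr (eq_empty_of_forall_notMem h))
  rw [this]
  refine measurableSet_setOfPred.2 (Measurable.or ?_ ?_)
  · exact (measurable_set_mem m).and
      (.forall fun j => measurable_const.imp (measurable_set_mem j).not)
  · exact measurable_const.and (.forall fun j => (measurable_set_mem j).not)

instance Set.instStandardBorelSpace {α : Type*} [Countable α] : StandardBorelSpace (Set α) :=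
  inferInstanceAs (StandardBorelSpace (α → Prop))

/-! ### Borel selection of monochromatic sets -/

/-- `y` is monochromatic for the two-colouring of `B` given by membership in `F`: all elements of
`B` contained in `y` have the same colour. -/
def IsMonochromatic (B F : Set (Finset ℕ)) (y : Set ℕ) : Prop :=
  (∀ s ∈ B, (s : Set ℕ) ⊆ y → s ∈ F) ∨ (∀ s ∈ B, (s : Set ℕ) ⊆ y → s ∉ F)

/-- There is a Borel map which sends every colouring `F` of `B` and every infinite `x ⊆ ℕ` to an
infinite monochromatic subset of `x`. -/
def HasBorelSelector (B : Set (Finset ℕ)) : Prop :=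
  ∃ S : Set (Finset ℕ) × Set ℕ → Set ℕ, Measurable S ∧ ∀ F x, x.Infinite →
    S (F, x) ⊆ x ∧ (S (F, x)).Infinite ∧ IsMonochromatic B F (S (F, x))

/-- The link of `B` at `u`: the sets lying entirely above `u` whose union with `u` is in `B`. -/
def linkAt (B : Set (Finset ℕ)) (u : Finset ℕ) : Set (Finset ℕ) :=
  {t | (∀ a ∈ u, ∀ b ∈ t, a < b) ∧ u ∪ t ∈ B}

theorem hasBorelSelector_of_subset_singleton {B : Set (Finset ℕ)} (hB : B ⊆ {∅}) :
    HasBorelSelector B := by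
  refine ⟨Prod.snd, measurable_snd, fun F x hx => ⟨subset_rfl, hx, ?_⟩⟩
  by_cases h : ∅ ∈ F
  · exact Or.inl fun s hs _ => by rwa [hB hs]
  · exact Or.inr fun s hs _ => by rwa [hB hs]

section Fusion

variable (S : ℕ → Set (Finset ℕ) × Set ℕ → Set ℕ)

/-- The decreasing sequence of sets obtained from `x` by repeatedly removing the least element `n`
and applying `S n` to the rest, with the colouring that `F` induces on the link at `n`. -/
noncomputable def fusionSeq (p : Set (Finset ℕ) × Set ℕ) : ℕ → Set ℕ
  | 0 => p.2
  | k + 1 => S (sInf (fusionSeq p k))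
      ({t | insert (sInf (fusionSeq p k)) t ∈ p.1}, fusionSeq p k ∩ Ioi (sInf (fusionSeq p k)))

/-- The least element of the `k`-th set of the fusion sequence. -/
noncomputable def pivot (p : Set (Finset ℕ) × Set ℕ) (k : ℕ) : ℕ :=
  sInf (fusionSeq S p k)

/-- The `k`-th pivot is positive if every set in the link of `B` at it that is contained in the next
set of the fusion sequence gives, together with the pivot, an element of `F`. -/
def IsPositivePivot (B : Set (Finset ℕ)) (p : Set (Finset ℕ) × Set ℕ) (k : ℕ) : Prop :=
  ∀ t ∈ linkAt B {pivot S p k}, (t : Set ℕ) ⊆ fusionSeq S p (k + 1) →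
    insert (pivot S p k) t ∈ p.1

/-- The set of all positive pivots if there are infinitely many, of all others if not. -/
def fusionSet (B : Set (Finset ℕ)) (p : Set (Finset ℕ) × Set ℕ) : Set ℕ :=
  {m | ∃ k, m = pivot S p k ∧
    (IsPositivePivot S B p k ↔ ∀ N, ∃ j, N ≤ j ∧ IsPositivePivot S B p j)}

variable {S}

theorem measurable_fusionSeq (hS : ∀ n, Measurable (S n)) (k : ℕ) :
    Measurable fun p => fusionSeq S p k := by
  induction k with
  | zero => exact measurable_snd
  | succ k ih =>
    have hS' : Measurable fun q : (Set (Finset ℕ) × Set ℕ) × ℕ => S q.2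
        ({t | insert q.2 t ∈ q.1.1}, q.1.2 ∩ Ioi q.2) := by
      refine measurable_from_prod_countable_left fun n => (hS n).comp (Measurable.prodMk ?_ ?_)
      · exact measurable_set_iff.2 fun t => measurable_fst.mem_apply (insert n t)
      · exact measurable_set_iff.2 fun m => (measurable_snd.mem_apply m).and
          (measurable_const (a := m ∈ Ioi n))
    exact hS'.comp ((measurable_fst.prodMk ih).prodMk (measurable_sInf_nat.comp ih))

theorem measurable_pivot (hS : ∀ n, Measurable (S n)) (k : ℕ) :
    Measurable fun p => pivot S p k :=
  measurable_sInf_nat.comp (measurable_fusionSeq hS k)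

theorem measurable_isPositivePivot (hS : ∀ n, Measurable (S n)) (B : Set (Finset ℕ)) (k : ℕ) :
    Measurable fun p => IsPositivePivot S B p k := by
  refine .forall fun t => .imp ?_ (.imp ?_ ?_)
  · exact (measurable_from_top (f := fun n : ℕ => t ∈ linkAt B {n})).comp (measurable_pivot hS k)
  · exact .forall fun m => .imp measurable_const ((measurable_fusionSeq hS (k + 1)).mem_apply m)
  · have : Measurable fun q : Set (Finset ℕ) × ℕ => insert q.2 t ∈ q.1 :=
      measurable_from_prod_countable_left fun n => measurable_set_mem (insert n t)
    exact this.comp (measurable_fst.prodMk (measurable_pivot hS k))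

theorem measurable_fusionSet (hS : ∀ n, Measurable (S n)) (B : Set (Finset ℕ)) :
    Measurable (fusionSet S B) := by
  refine measurable_set_iff.2 fun m => .exists fun k => .and ?_ (.iff ?_ ?_)
  · exact (measurable_pivot hS k).eq_apply_nat m
  · exact measurable_isPositivePivot hS B k
  · exact .forall fun N => .exists fun j => measurable_const.and (measurable_isPositivePivot hS B j)

theorem Set.Infinite.inter_Ioi {x : Set ℕ} (hx : x.Infinite) (n : ℕ) : (x ∩ Ioi n).Infinite :=
  (hx.sdiff (finite_Iic n)).mono fun _ hm => ⟨hm.1, lt_of_not_ge fun h => hm.2 (mem_Iic.2 h)⟩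

variable (hS : ∀ n F x, x.Infinite → S n (F, x) ⊆ x ∧ (S n (F, x)).Infinite)
  {p : Set (Finset ℕ) × Set ℕ} (hp : p.2.Infinite)
include hS hp

theorem infinite_fusionSeq (k : ℕ) : (fusionSeq S p k).Infinite := by
  induction k with
  | zero => exact hp
  | succ k ih => exact (hS _ _ _ (ih.inter_Ioi _)).2

theorem fusionSeq_succ_subset (k : ℕ) :
    fusionSeq S p (k + 1) ⊆ fusionSeq S p k ∩ Ioi (pivot S p k) :=
  (hS _ _ _ ((infinite_fusionSeq hS hp k).inter_Ioi _)).1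

theorem antitone_fusionSeq : Antitone (fusionSeq S p) :=
  antitone_nat_of_succ_le fun k => (fusionSeq_succ_subset hS hp k).trans inter_subset_left

theorem pivot_mem (k : ℕ) : pivot S p k ∈ fusionSeq S p k :=
  Nat.sInf_mem (infinite_fusionSeq hS hp k).nonempty

theorem strictMono_pivot : StrictMono (pivot S p) :=
  strictMono_nat_of_lt_succ fun k => (fusionSeq_succ_subset hS hp k (pivot_mem hS hp (k + 1))).2

theorem fusionSet_subset (B : Set (Finset ℕ)) : fusionSet S B p ⊆ p.2 := by
  rintro _ ⟨k, rfl, -⟩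
  exact antitone_fusionSeq hS hp (Nat.zero_le k) (pivot_mem hS hp k)

theorem infinite_fusionSet (B : Set (Finset ℕ)) : (fusionSet S B p).Infinite := by
  have key : {k | IsPositivePivot S B p k ↔ ∀ N, ∃ j, N ≤ j ∧ IsPositivePivot S B p j}.Infinite := by
    rw [← Nat.frequently_atTop_iff_infinite, frequently_atTop]
    intro N
    by_cases h : ∀ N, ∃ j, N ≤ j ∧ IsPositivePivot S B p j
    · obtain ⟨j, hj, hj'⟩ := h N
      exact ⟨j, hj, iff_of_true hj' h⟩
    · obtain ⟨M, hM⟩ := not_forall.1 h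
      exact ⟨max M N, le_max_right _ _,
        iff_of_false (fun h' => hM ⟨_, le_max_left _ _, h'⟩) h⟩
  refine (key.image (strictMono_pivot hS hp).injective.injOn).mono ?_
  rintro _ ⟨k, hk, rfl⟩
  exact ⟨k, rfl, hk⟩

/-- A nonempty subset of the fusion set has a pivot as its least element, and the rest of it lies in
the next set of the fusion sequence. -/
theorem exists_eq_insert_pivot {B : Set (Finset ℕ)} {s : Finset ℕ} (hs : s.Nonempty)
    (hsub : (s : Set ℕ) ⊆ fusionSet S B p) :
    ∃ k t, s = insert (pivot S p k) t ∧ (∀ m ∈ t, pivot S p k < m) ∧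
      (t : Set ℕ) ⊆ fusionSeq S p (k + 1) ∧
      (IsPositivePivot S B p k ↔ ∀ N, ∃ j, N ≤ j ∧ IsPositivePivot S B p j) := by
  obtain ⟨k, hk, hpos⟩ := hsub (s.min'_mem hs)
  have hlt : ∀ m ∈ s.erase (pivot S p k), pivot S p k < m := fun m hm =>
    lt_of_le_of_ne (hk ▸ s.min'_le m (Finset.mem_of_mem_erase hm)) (Finset.ne_of_mem_erase hm).symm
  refine ⟨k, s.erase (pivot S p k), (Finset.insert_erase (hk ▸ s.min'_mem hs)).symm, hlt,
    fun m hm => ?_, hpos⟩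
  obtain ⟨j, rfl, -⟩ := hsub (Finset.mem_of_mem_erase hm)
  have hkj : k < j := (strictMono_pivot hS hp).lt_iff_lt.1 (hlt _ hm)
  exact antitone_fusionSeq hS hp hkj (pivot_mem hS hp j)

end Fusion

/-- The pigeonhole step: the colour of a set contained in the fusion set is that of its least
element, so selectors for all the links give one for the whole family. -/
theorem HasBorelSelector.of_linkAt {B : Set (Finset ℕ)} (hB : ∅ ∉ B)
    (h : ∀ n, HasBorelSelector (linkAt B {n})) : HasBorelSelector B := by
  choose S hSm hS using h
  have hS' : ∀ n F x, x.Infinite → S n (F, x) ⊆ x ∧ (S n (F, x)).Infinite :=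
    fun n F x hx => ⟨(hS n F x hx).1, (hS n F x hx).2.1⟩
  refine ⟨fusionSet S B, measurable_fusionSet hSm B, fun F x hx =>
    ⟨fusionSet_subset hS' hx B, infinite_fusionSet hS' hx B, ?_⟩⟩
  have key : ∀ s ∈ B, (s : Set ℕ) ⊆ fusionSet S B (F, x) →
      (s ∈ F ↔ ∀ N, ∃ j, N ≤ j ∧ IsPositivePivot S B (F, x) j) := by
    intro s hs hsub
    have hne : s.Nonempty := Finset.nonempty_iff_ne_empty.2 fun h => hB (h ▸ hs)
    obtain ⟨k, t, rfl, hlt, ht, hpos⟩ := exists_eq_insert_pivot hS' hx hne hsub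
    have htl : t ∈ linkAt B {pivot S (F, x) k} := ⟨by simpa using hlt, hs⟩
    rw [← hpos]
    refine ⟨fun hF => ?_, fun hpos => hpos t htl ht⟩
    -- The next set is monochromatic for the link, so the colour of `t` decides the other sets.
    rcases (hS (pivot S (F, x) k) {t | insert (pivot S (F, x) k) t ∈ F} _
      ((infinite_fusionSeq (p := (F, x)) hS' hx k).inter_Ioi (pivot S (F, x) k))).2.2 with
      hmono | hmono
    · exact hmono
    · exact absurd hF (hmono t htl ht)
  by_cases hc : ∀ N, ∃ j, N ≤ j ∧ IsPositivePivot S B (F, x) j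
  · exact Or.inl fun s hs hsub => (key s hs hsub).2 hc
  · exact Or.inr fun s hs hsub hF => hc ((key s hs hsub).1 hF)

theorem HasBorelSelector.mono {B C : Set (Finset ℕ)} (hC : HasBorelSelector C) (hBC : B ⊆ C) :
    HasBorelSelector B := by
  obtain ⟨S, hSm, hS⟩ := hC
  refine ⟨S, hSm, fun F x hx => ⟨(hS F x hx).1, (hS F x hx).2.1, ?_⟩⟩
  exact (hS F x hx).2.2.imp (fun h s hs => h s (hBC hs)) (fun h s hs => h s (hBC hs))

theorem linkAt_linkAt_singleton_subset (B : Set (Finset ℕ)) (u : Finset ℕ) (n : ℕ) :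
    linkAt (linkAt B u) {n} ⊆ linkAt B (insert n u) := by
  rintro t ⟨h1, h2, h3⟩
  refine ⟨fun a ha b hb => ?_, ?_⟩
  · rcases Finset.mem_insert.1 ha with rfl | ha
    · exact h1 a (Finset.mem_singleton_self a) b hb
    · exact h2 a ha b (Finset.mem_union_right _ hb)
  · rwa [← Finset.union_assoc, Finset.union_singleton] at h3

theorem linkAt_linkAt_singleton_eq_empty {B : Set (Finset ℕ)} {u : Finset ℕ} {n : ℕ}
    (h : ¬ ∀ a ∈ u, a < n) : linkAt (linkAt B u) {n} = ∅ :=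
  eq_empty_of_forall_notMem fun _ ht =>
    h fun a ha => ht.2.1 a ha n (Finset.mem_union_left _ (Finset.mem_singleton_self n))

theorem IsFrontOn.linkAt_subset_singleton {B : Set (Finset ℕ)} {x : Set ℕ} (hB : IsFrontOn B x)
    {u : Finset ℕ} (hu : u ∈ B) : linkAt B u ⊆ {∅} := by
  rintro t ⟨hlt, ht⟩
  by_contra hne
  obtain ⟨b, hb⟩ := Finset.nonempty_iff_ne_empty.2 hne
  refine hB.incomparable u hu _ ht (fun h => ?_)
    ⟨t.min' ⟨b, hb⟩, ext fun m => ⟨fun hm => ⟨?_, hlt m hm _ (t.min'_mem _)⟩, fun hm => ?_⟩⟩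
  · exact lt_irrefl b (hlt b (h ▸ Finset.mem_union_right u hb) b hb)
  · exact Finset.mem_coe.2 (Finset.mem_union_left t hm)
  · exact (Finset.mem_union.1 hm.1).resolve_right fun hmt => not_le.2 hm.2 (t.min'_le m hmt)

theorem IsFrontOn.exists_not_hasBorelSelector {B : Set (Finset ℕ)} {x : Set ℕ}
    (hB : IsFrontOn B x) {u : Finset ℕ} (hu : ¬ HasBorelSelector (linkAt B u)) :
    ∃ n, (∀ a ∈ u, a < n) ∧ ¬ HasBorelSelector (linkAt B (insert n u)) := by
  by_contra! hcon
  refine hu (.of_linkAt (fun h => hu ?_) fun n => ?_)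
  · refine hasBorelSelector_of_subset_singleton (hB.linkAt_subset_singleton ?_)
    simpa using h.2
  · by_cases hn : ∀ a ∈ u, a < n
    · exact (hcon n hn).mono (linkAt_linkAt_singleton_subset B u n)
    · rw [linkAt_linkAt_singleton_eq_empty hn]
      exact hasBorelSelector_of_subset_singleton (empty_subset _)

/-- A Borel version of the Nash-Williams theorem. If it failed for `B`, then it would fail for the
links at all initial segments of some infinite set, one of which belongs to `B`. -/
theorem IsFrontOn.hasBorelSelector {B : Set (Finset ℕ)} (hB : IsFrontOn B univ) :
    HasBorelSelector B := by
  by_contra hcon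
  have hstep : ∀ u, ∃ n, ¬ HasBorelSelector (linkAt B u) →
      (∀ a ∈ u, a < n) ∧ ¬ HasBorelSelector (linkAt B (insert n u)) := fun u => by
    by_cases hu : HasBorelSelector (linkAt B u)
    · exact ⟨0, fun h => absurd hu h⟩
    · exact (hB.exists_not_hasBorelSelector hu).imp fun _ h _ => h
  choose g hg using hstep
  let u : ℕ → Finset ℕ := fun k => Nat.rec ∅ (fun _ v => insert (g v) v) k
  have hu : ∀ k, ¬ HasBorelSelector (linkAt B (u k)) := by
    intro k
    induction k with
    | zero => exact fun h => hcon (h.mono fun t ht => ⟨by simp [u], by simpa [u] using ht⟩)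
    | succ k ih => exact (hg _ ih).2
  have hmono : StrictMono fun k => g (u k) := strictMono_nat_of_lt_succ fun k =>
    (hg _ (hu (k + 1))).1 _ (Finset.mem_insert_self _ _)
  have hmem : ∀ k m, m ∈ u k ↔ ∃ i < k, g (u i) = m := by
    intro k m
    induction k with
    | zero => simp [u]
    | succ k ih =>
      change m ∈ insert (g (u k)) (u k) ↔ _
      rw [Finset.mem_insert, ih, Nat.exists_lt_succ_right, or_comm, eq_comm (a := m)]
  obtain ⟨s, hs, N, hN⟩ := hB.exists_initSeg (range fun k => g (u k)) (subset_univ _)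
    (infinite_range_of_injective hmono.injective)
  have hex : ∃ k, N ≤ g (u k) := ⟨N, hmono.le_apply⟩
  have hsu : s = u (Nat.find hex) := by
    ext m
    rw [← Finset.mem_coe, hN, hmem]
    constructor
    · rintro ⟨⟨i, rfl⟩, hi⟩
      exact ⟨i, hmono.lt_iff_lt.1 (lt_of_lt_of_le hi (Nat.find_spec hex)), rfl⟩
    · rintro ⟨i, hi, rfl⟩
      exact ⟨⟨i, rfl⟩, not_le.1 (Nat.find_min hex hi)⟩
  exact hu _ (hasBorelSelector_of_subset_singleton (hB.linkAt_subset_singleton (hsu ▸ hs)))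

theorem IsFrontOn.mem_homFamily {B F : Set (Finset ℕ)} (hB : IsFrontOn B univ) (hF : F ⊆ B)
    {y : Set ℕ} (hy : IsMonochromatic B F y) : y ∈ homFamily F := by
  refine hy.imp (fun h z hz hinf => ?_) (fun h s hs hsF => h s (hF hsF) hs hsF)
  obtain ⟨s, hs, n, hn⟩ := hB.exists_initSeg z (subset_univ z) hinf
  exact ⟨s, h s hs ((hn.le.trans inter_subset_left).trans hz), n, hn⟩

/-! ### A Borel almost disjoint family -/

/-- The branch of `F` in the tree of finite approximations `(n, s)`, where `s` is the set of elements
of `F` with code below `n`; the nodes of the tree are identified with their codes. -/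
def branch {α : Type*} [Encodable α] (F : Set α) : Set ℕ :=
  {m | ∃ (n : ℕ) (s : Finset α), m = Encodable.encode (n, s) ∧
    ∀ t, t ∈ s ↔ Encodable.encode t < n ∧ t ∈ F}

section Branch

variable {α : Type*} [Encodable α]

theorem measurable_branch : Measurable (branch : Set α → Set ℕ) :=
  measurable_set_iff.2 fun _ => .exists fun _ => .exists fun _ => measurable_const.and
    (.forall fun t => measurable_const.iff (measurable_const.and (measurable_set_mem t)))

theorem finite_setOf_encode_lt (F : Set α) (n : ℕ) :
    {t : α | Encodable.encode t < n ∧ t ∈ F}.Finite :=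
  ((finite_Iio n).preimage Encodable.encode_injective.injOn).subset fun _ ht => ht.1

theorem infinite_branch (F : Set α) : (branch F).Infinite := by
  refine infinite_of_injective_forall_mem
    (f := fun n => Encodable.encode (n, (finite_setOf_encode_lt F n).toFinset)) (fun n n' h => ?_)
    (fun n => ⟨n, _, rfl, fun t => by simp⟩)
  exact (Prod.ext_iff.1 (Encodable.encode_injective h)).1

theorem finite_branch_inter_branch {F G : Set α} (h : F ≠ G) : (branch F ∩ branch G).Finite := by
  obtain ⟨t, ht⟩ : ∃ t, ¬ (t ∈ F ↔ t ∈ G) := by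
    by_contra! hcon
    exact h (ext hcon)
  -- A common node cannot decide `t`; there are finitely many such nodes on a branch.
  refine ((finite_Iic (Encodable.encode t)).image
    fun n => Encodable.encode (n, (finite_setOf_encode_lt F n).toFinset)).subset ?_
  rintro _ ⟨⟨n, s, rfl, hs⟩, ⟨n', s', heq, hs'⟩⟩
  obtain ⟨rfl, rfl⟩ := Prod.ext_iff.1 (Encodable.encode_injective heq)
  refine ⟨n, mem_Iic.2 (not_lt.1 fun hlt => ht ?_), ?_⟩
  · simpa [hlt] using (hs t).symm.trans (hs' t)
  · have hss : (finite_setOf_encode_lt F n).toFinset = s := Finset.ext fun t => by simp [hs]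
    simp [hss]

end Branch

/-! ### Sets of relative density zero -/

open scoped Classical in
/-- The number of elements of `x` below `n`. -/
noncomputable def countBelow (x : Set ℕ) (n : ℕ) : ℕ := ∑ i ∈ Finset.range n, if i ∈ x then 1 else 0

/-- `y` has density zero relative to `h`, in the form that for every `c` the set `y` has at most
`1 / c` times as many elements below `n` as `h`, for all large `n`. -/
def IsSparseIn (h y : Set ℕ) : Prop :=
  ∀ c : ℕ, ∃ N, ∀ n, N ≤ n → c * countBelow y n ≤ countBelow h n

theorem countBelow_mono_left {x y : Set ℕ} (h : x ⊆ y) (n : ℕ) :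
    countBelow x n ≤ countBelow y n := by
  refine Finset.sum_le_sum fun i _ => ?_
  by_cases hx : i ∈ x
  · simp [hx, h hx]
  · simp [hx]

theorem countBelow_mono_right (x : Set ℕ) : Monotone (countBelow x) := fun _ _ h =>
  Finset.sum_le_sum_of_subset (Finset.range_mono h)

theorem countBelow_union_le (x y : Set ℕ) (n : ℕ) :
    countBelow (x ∪ y) n ≤ countBelow x n + countBelow y n := by
  rw [countBelow, countBelow, countBelow, ← Finset.sum_add_distrib]
  refine Finset.sum_le_sum fun i _ => ?_
  by_cases hx : i ∈ x <;> by_cases hy : i ∈ y <;> simp [hx, hy]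

theorem countBelow_eq_card {x : Set ℕ} {n : ℕ} {s : Finset ℕ}
    (hs : ∀ i, i ∈ s ↔ i < n ∧ i ∈ x) : countBelow x n = s.card := by
  classical
  rw [countBelow, Finset.sum_boole, Nat.cast_id]
  congr 1
  ext i
  simp [hs]

theorem countBelow_le_card {x : Set ℕ} {s : Finset ℕ} (hs : ∀ i ∈ x, i ∈ s) (n : ℕ) :
    countBelow x n ≤ s.card := by
  classical
  rw [countBelow_eq_card (s := s.filter fun i => i < n ∧ i ∈ x)
    fun i => by simp only [Finset.mem_filter]; exact ⟨fun h => h.2, fun h => ⟨hs i h.2, h⟩⟩]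
  exact Finset.card_filter_le _ _

theorem tendsto_countBelow {x : Set ℕ} (hx : x.Infinite) :
    Tendsto (countBelow x) atTop atTop := by
  refine tendsto_atTop_atTop_of_monotone (countBelow_mono_right x) fun b => ?_
  obtain ⟨s, hs, rfl⟩ := hx.exists_subset_card_eq b
  refine ⟨s.sup id + 1, ?_⟩
  classical
  rw [countBelow_eq_card (s := (Finset.range (s.sup id + 1)).filter (· ∈ x)) (by simp)]
  refine Finset.card_le_card fun i hi => ?_
  simpa using ⟨Finset.le_sup (f := id) hi, hs hi⟩

theorem measurable_countBelow (n : ℕ) : Measurable fun x : Set ℕ => countBelow x n := by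
  classical
  exact Finset.measurable_sum _ fun i _ =>
    Measurable.ite (measurableSet_setOfPred.2 (measurable_set_mem i)) measurable_const measurable_const

theorem measurable_isSparseIn :
    Measurable fun q : Set ℕ × Set ℕ => IsSparseIn q.1 q.2 := by
  refine .forall fun c => .exists fun N => .forall fun n => measurable_const.imp ?_
  have h := ((measurable_countBelow n).comp measurable_fst).prodMk
    ((measurable_countBelow n).comp (measurable_snd (α := Set ℕ) (β := Set ℕ)))
  exact (Measurable.of_discrete (f := fun r : ℕ × ℕ => c * r.2 ≤ r.1)).comp h

namespace IsSparseIn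

variable {h x y : Set ℕ}

theorem mono (hy : IsSparseIn h y) (hxy : x ⊆ y) : IsSparseIn h x := fun c => by
  obtain ⟨N, hN⟩ := hy c
  exact ⟨N, fun n hn => (Nat.mul_le_mul_left c (countBelow_mono_left hxy n)).trans (hN n hn)⟩

theorem union (hx : IsSparseIn h x) (hy : IsSparseIn h y) : IsSparseIn h (x ∪ y) := fun c => by
  obtain ⟨N, hN⟩ := hx (2 * c)
  obtain ⟨M, hM⟩ := hy (2 * c)
  refine ⟨max N M, fun n hn => ?_⟩
  have h1 := hN n (le_of_max_le_left hn)
  have h2 := hM n (le_of_max_le_right hn)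
  have h3 := Nat.mul_le_mul_left c (countBelow_union_le x y n)
  linarith

theorem of_finite (hh : h.Infinite) (hx : x.Finite) : IsSparseIn h x := fun c => by
  obtain ⟨N, hN⟩ := eventually_atTop.1
    ((tendsto_countBelow hh).eventually_ge_atTop (c * hx.toFinset.card))
  exact ⟨N, fun n hn => (Nat.mul_le_mul_left c
    (countBelow_le_card (fun i hi => hx.mem_toFinset.2 hi) n)).trans (hN n hn)⟩

theorem not_self (hh : h.Infinite) : ¬ IsSparseIn h h := fun hs => by
  obtain ⟨N, hN⟩ := hs 2
  obtain ⟨n, hn, hpos⟩ := ((eventually_ge_atTop N).and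
    ((tendsto_countBelow hh).eventually_ge_atTop 1)).exists
  have := hN n hn
  omega

/-- Take the `k`-th element of the subset so large that `h` has at least `(k + 1) ^ 2` elements below
it. -/
theorem exists_infinite_subset (hh : h.Infinite) (hx : x.Infinite) :
    ∃ y ⊆ x, y.Infinite ∧ IsSparseIn h y := by
  obtain ⟨φ, hφ, hφx⟩ := extraction_forall_of_frequently
    (P := fun k n => n ∈ x ∧ (k + 1) ^ 2 ≤ countBelow h n) fun k =>
      (Nat.frequently_atTop_iff_infinite.2 hx).and_eventually
        ((tendsto_countBelow hh).eventually_ge_atTop _)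
  refine ⟨range φ, range_subset_iff.2 fun k => (hφx k).1,
    infinite_range_of_injective hφ.injective, fun c => ?_⟩
  obtain ⟨N, hN⟩ := eventually_atTop.1 ((tendsto_countBelow hh).eventually_ge_atTop (c * c))
  refine ⟨N, fun n hn => ?_⟩
  have hex : ∃ k, n ≤ φ k := ⟨n, hφ.le_apply⟩
  have hlt : ∀ i, i < Nat.find hex ↔ φ i < n := fun i =>
    ⟨fun hi => not_le.1 (Nat.find_min hex hi),
      fun hi => hφ.lt_iff_lt.1 (hi.trans_le (Nat.find_spec hex))⟩
  have hcard : countBelow (range φ) n = Nat.find hex := by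
    rw [countBelow_eq_card (s := (Finset.range (Nat.find hex)).image φ),
      Finset.card_image_of_injective _ hφ.injective, Finset.card_range]
    intro i
    simp only [Finset.mem_image, Finset.mem_range, hlt, mem_range]
    constructor
    · rintro ⟨j, hj, rfl⟩
      exact ⟨hj, j, rfl⟩
    · rintro ⟨hj, j, rfl⟩
      exact ⟨j, hj, rfl⟩
  rw [hcard]
  rcases le_total (Nat.find hex) c with hc | hc
  · exact (Nat.mul_le_mul_left c hc).trans (hN n hn)
  · rcases Nat.eq_zero_or_pos (Nat.find hex) with h0 | hpos
    · simp [h0]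
    · obtain ⟨k, hk⟩ := Nat.exists_eq_add_one.2 hpos
      rw [hk] at hc ⊢
      have h1 := countBelow_mono_right h ((hlt k).1 (by omega)).le
      have h2 := (hφx k).2
      nlinarith

end IsSparseIn

/-! ### The ideal attached to an almost disjoint family -/

/-- The sets whose trace on each `h a` has density zero relative to `h a`. -/
def sparseIdeal {α : Type*} (h : α → Set ℕ) : Set (Set ℕ) :=
  {y | ∀ a, IsSparseIn (h a) (y ∩ h a)}

section SparseIdeal

variable {α : Type*} {h : α → Set ℕ}

theorem isIdealOnNat_sparseIdeal (hinf : ∀ a, (h a).Infinite) : IsIdealOnNat (sparseIdeal h) where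
  finite_mem _ hx a := .of_finite (hinf a) (hx.inter_of_left _)
  hereditary _ hx _ hyx a := (hx a).mono (inter_subset_inter_left _ hyx)
  union_mem x hx y hy a := by
    rw [union_inter_distrib_right]
    exact (hx a).union (hy a)

theorem notMem_sparseIdeal (hinf : ∀ a, (h a).Infinite) (a : α) : h a ∉ sparseIdeal h := fun ha =>
  IsSparseIn.not_self (hinf a) (by simpa using ha a)

theorem isTall_sparseIdeal (hinf : ∀ a, (h a).Infinite)
    (hdisj : ∀ a b, a ≠ b → (h a ∩ h b).Finite) : IsTall (sparseIdeal h) := by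
  intro x hx
  by_cases hfin : ∀ a, (x ∩ h a).Finite
  · exact ⟨x, fun a => .of_finite (hinf a) (hfin a), hx, subset_rfl⟩
  · obtain ⟨a, ha⟩ := not_forall.1 hfin
    obtain ⟨y, hyx, hy, hsparse⟩ := IsSparseIn.exists_infinite_subset (hinf a) ha
    refine ⟨y, fun b => ?_, hy, hyx.trans inter_subset_left⟩
    by_cases hab : a = b
    · subst hab
      exact hsparse.mono inter_subset_left
    · exact .of_finite (hinf b) ((hdisj a b hab).subset
        (inter_subset_inter_left _ (hyx.trans inter_subset_right)))

/-- The complement of the ideal is the projection of the Borel set of all `(a, y)` such that the trace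
of `y` on `h a` is not sparse. -/
theorem isCoanalyticFamily_sparseIdeal [MeasurableSpace α] [StandardBorelSpace α]
    (hh : Measurable h) : IsCoanalyticFamily (sparseIdeal h) := by
  have hset : Measurable fun q : α × (ℕ → Bool) => {n | q.2 n = true} :=
    measurable_set_iff.2 fun n => (measurable_from_top (f := fun b : Bool => b = true)).comp
      ((measurable_pi_apply n).comp measurable_snd)
  have htrace : Measurable fun q : α × (ℕ → Bool) => {n | q.2 n = true} ∩ h q.1 :=
    measurable_set_iff.2 fun n => (hset.mem_apply n).and ((hh.comp measurable_fst).mem_apply n)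
  have hmeas : MeasurableSet {q : α × (ℕ → Bool) |
      ¬ IsSparseIn (h q.1) ({n | q.2 n = true} ∩ h q.1)} :=
    measurableSet_setOfPred.2
      (measurable_isSparseIn.comp ((hh.comp measurable_fst).prodMk htrace)).not
  have himage : {f : ℕ → Bool | {n | f n = true} ∉ sparseIdeal h} =
      Prod.snd '' {q : α × (ℕ → Bool) |
        ¬ IsSparseIn (h q.1) ({n | q.2 n = true} ∩ h q.1)} := by
    ext f
    simp [sparseIdeal]
  rw [IsCoanalyticFamily, himage]
  exact hmeas.analyticSet_image measurable_snd

end SparseIdeal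

theorem mainTheorem9 (B : Set (Finset ℕ)) (hB : IsFrontOn B Set.univ) :
    ∃ I : Set (Set ℕ), IsIdealOnNat I ∧ IsTall I ∧ IsCoanalyticFamily I ∧
      ∀ F : Set (Finset ℕ), F ⊆ B → ¬ (homFamily F ⊆ I) := by
  obtain ⟨S, hSm, hS⟩ := hB.hasBorelSelector
  let h : Set (Finset ℕ) → Set ℕ := fun F => S (F, branch F)
  have hh : ∀ F, h F ⊆ branch F ∧ (h F).Infinite ∧ IsMonochromatic B F (h F) :=
    fun F => hS F (branch F) (infinite_branch F)
  have hinf : ∀ F, (h F).Infinite := fun F => (hh F).2.1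
  refine ⟨sparseIdeal h, isIdealOnNat_sparseIdeal hinf, isTall_sparseIdeal hinf fun F G hFG => ?_,
    isCoanalyticFamily_sparseIdeal (hSm.comp (measurable_id.prodMk measurable_branch)),
    fun F hF hsub => notMem_sparseIdeal hinf F (hsub (hB.mem_homFamily hF (hh F).2.2))⟩
  exact (finite_branch_inter_branch hFG).subset (inter_subset_inter (hh F).1 (hh G).1)
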